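/- Let $H$ be a complex Hilbert space. A nest on $H$ is a chain $\mathcal N$ of closed subspaces of $H$ that contains $\{0\}$ and $H$ and is closed under arbitrary intersections and arbitrary closed linear spans; it is nontrivial if $\mathcal N\neq\{\{0\},H\}$. Its nest algebra is $\mathcal T(\mathcal N)=\{T\in B(H): T(M)\subseteq M \text{ for all } M\in\mathcal N\}$. For elements of a ring put $a\circ b=ab+ba$, $q_1(t_1)=t_1$ and $q_n(t_1,\dots,t_n)=q_{n-1}(t_1,\dots,t_{n-1})\circ t_n$ for $n\ge 2$. A map $\delta$ from a ring $\mathfrak A$ to itself (not assumed additive) is a multiplicative Jordan $n$-derivation if $$\delta(q_n(t_1,\dots,t_n))=\sum_{i=1}^n q_n(t_1,\dots,t_{i-1},\delta(t_i),t_{i+1},\dots,t_n)$$ for all $t_1,\dots,t_n\in\mathfrak A$. A map $\Delta:\mathfrak A\to\mathfrak A$ (not assumed additive) is a multiplicative generalized Jordan $n$-derivation if there is a multiplicative Jordan $n$-derivation $\delta:\mathfrak A\to\mathfrak A$ such that $$\Delta(q_n(t_1,\dots,t_n))=q_n(\Delta(t_1),t_2,\dots,t_n)+\sum_{i=2}^n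 q_n(t_1,\dots,t_{i-1},\delta(t_i),t_{i+1},\dots,t_n)$$ for all $t_1,\dots,t_n\in\mathfrak A$. A derivation of $\mathfrak A$ is an additive map $\delta:\mathfrak A\to\mathfrak A$ with $\delta(ab)=\delta(a)b+a\delta(b)$ for all $a,b\in\mathfrak A$. **Corollary.** Let $\mathcal N$ be a nontrivial nest on a complex Hilbert space $H$ and let $n\ge 2$ be an integer. Then for every multiplicative generalized Jordan $n$-derivation $\Delta:\mathcal T(\mathcal N)\to\mathcal T(\mathcal N)$ there are $\mu\in\mathbb C1$ and a derivation $\delta:\mathcal T(\mathcal N)\to\mathcal T(\mathcal N)$ such that $\Delta(t)=\mu t+\delta(t)$ for all $t\in\mathcal T(\mathcal N)$. -/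

import Mathlib

section JordanMaps

variable {A : Type*} [Ring A]

/-- The Jordan product `a ∘ b = ab + ba` (without the factor `1/2`). -/
def jordanProd (a b : A) : A := a * b + b * a

/-- `jordanPoly n (t₁, …, tₙ) = qₙ(t₁, …, tₙ)`, where `q₁(t₁) = t₁` and
`qₙ(t₁, …, tₙ) = qₙ₋₁(t₁, …, tₙ₋₁) ∘ tₙ` for `n ≥ 2`. The value at `n = 0` is irrelevant. -/
def jordanPoly : (n : ℕ) → (Fin n → A) → A
  | 0, _ => 0
  | 1, t => t 0
  | n + 2, t => jordanProd (jordanPoly (n + 1) (Fin.init t)) (t (Fin.last (n + 1)))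

/-- A map `δ : A → A`, not assumed additive, with
`δ(qₙ(t₁, …, tₙ)) = ∑ᵢ qₙ(t₁, …, tᵢ₋₁, δ(tᵢ), tᵢ₊₁, …, tₙ)`. -/
def IsMulJordanDerivation (n : ℕ) (δ : A → A) : Prop :=
  ∀ t : Fin n → A,
    δ (jordanPoly n t) = ∑ i, jordanPoly n (Function.update t i (δ (t i)))

/-- A map `Δ : A → A`, not assumed additive, for which there is a multiplicative Jordan
`n`-derivation `δ`, also not assumed additive, with
`Δ(qₙ(t₁, …, tₙ)) = qₙ(Δ(t₁), t₂, …, tₙ) + ∑_{i ≥ 2} qₙ(t₁, …, δ(tᵢ), …, tₙ)`.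
The first entry `t₁` has index `0 : Fin n`. -/
def IsMulGenJordanDerivation (n : ℕ) [NeZero n] (Δ : A → A) : Prop :=
  ∃ δ : A → A, IsMulJordanDerivation n δ ∧
    ∀ t : Fin n → A,
      Δ (jordanPoly n t) =
        jordanPoly n (Function.update t 0 (Δ (t 0))) +
          ∑ i ∈ Finset.univ.filter (fun i : Fin n => i ≠ 0),
            jordanPoly n (Function.update t i (δ (t i)))

/-- A derivation of a (not necessarily commutative) ring: an additive map satisfying the
Leibniz rule. -/
structure IsRingDerivation (δ : A → A) : Prop where
  map_add : ∀ a b, δ (a + b) = δ a + δ b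
  leibniz : ∀ a b, δ (a * b) = δ a * b + a * δ b

end JordanMaps

section Nests

variable {H : Type*} [NormedAddCommGroup H] [InnerProductSpace ℂ H]

/-- A nest: a chain of closed subspaces of `H` containing `{0}` and `H` and closed under
arbitrary intersections and closed linear spans (the infima and suprema in the lattice of
closed subspaces). -/
structure IsNest (N : Set (ClosedSubmodule ℂ H)) : Prop where
  chain : IsChain (· ≤ ·) N
  bot_mem : ⊥ ∈ N
  top_mem : ⊤ ∈ N
  sInf_mem : ∀ S ⊆ N, sInf S ∈ N
  sSup_mem : ∀ S ⊆ N, sSup S ∈ N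

/-- The nest algebra `T(N)`: all bounded operators leaving every member of `N` invariant. -/
def nestAlgebra (N : Set (ClosedSubmodule ℂ H)) : Subalgebra ℂ (H →L[ℂ] H) where
  carrier := {T | ∀ M ∈ N, ∀ x ∈ M, T x ∈ M}
  mul_mem' := fun {S T} hS hT M hM x hx => hS M hM (T x) (hT M hM x hx)
  add_mem' := fun {S T} hS hT M hM x hx =>
    M.toSubmodule.add_mem (hS M hM x hx) (hT M hM x hx)
  algebraMap_mem' := fun c M _ x hx => by
    simpa [Algebra.algebraMap_eq_smul_one] using M.toSubmodule.smul_mem c hx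

end Nests

/-! ### Leibniz rules as folds over dual numbers. -/

section Polarization

variable {A : Type*} [Ring A]

/-! Let `e` be the projection onto some `M` in the nest other than `⊥` and `⊤`. Then `(1 - e)Ae =
0`, and rank-one operators carrying `Mᗮ` into `M` make the corner `eA(1 - e)` faithful on both
sides. The rest is algebra around `e`, except that the centre must be scalar.

The map `· ∘ e` acts on the three Peirce corners `eAe`, `eA(1 - e)`, `(1 - e)A(1 - e)` as 2, 1, 0.
Padding `qₙ` with `e` therefore fixes off-diagonal elements `m`, and the `n`-ary rule collapses to
the binary one for `m ∘ x` (`map_offDiag_jordanProd`). An inner derivation normalizes `δ` so that `δ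
e = δ 1 = 0`; then `δ` preserves Peirce components and obeys the product rule for `x * m` and `m *
x`. Expanding `δ ((x + y) * m)` and `δ (x * y * m)` in two ways, faithfulness gives additivity and
the Leibniz rule.

So the given `δ` is already a derivation. The difference `Δ - δ` obeys the same identity with no
derivation terms, which makes it multiplication by a central element. -/

lemma jordanProd_comm (a b : A) : jordanProd a b = jordanProd b a := add_comm _ _

lemma jordanProd_add (a b c : A) : jordanProd a (b + c) = jordanProd a b + jordanProd a c := by
  unfold jordanProd; noncomm_ring

lemma add_jordanProd (a b c : A) : jordanProd (a + b) c = jordanProd a c + jordanProd b c := by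
  unfold jordanProd; noncomm_ring

@[simp] lemma jordanProd_zero (a : A) : jordanProd a 0 = 0 := by simp [jordanProd]

@[simp] lemma zero_jordanProd (a : A) : jordanProd 0 a = 0 := by simp [jordanProd]

lemma sum_jordanProd {ι : Type*} (s : Finset ι) (f : ι → A) (b : A) :
    jordanProd (∑ i ∈ s, f i) b = ∑ i ∈ s, jordanProd (f i) b := by
  simp [jordanProd, Finset.sum_mul, Finset.mul_sum, Finset.sum_add_distrib]

/-- The Jordan product of dual numbers `a + εa'`, `b + εb'`, written as pairs. -/
def dualJordanProd (p q : A × A) : A × A :=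
  (jordanProd p.1 q.1, jordanProd p.2 q.1 + jordanProd p.1 q.2)

/-- With ε² = 0, the ε-coefficient of `qₙ(tᵢ + εsᵢ)` is the sum of all single substitutions, since
`qₙ` is multilinear. -/
lemma foldl_dualJordanProd_ofFn (k : ℕ) (t s : Fin (k + 1) → A) :
    (List.ofFn (fun i : Fin k => (t i.succ, s i.succ))).foldl dualJordanProd (t 0, s 0) =
      (jordanPoly (k + 1) t, ∑ i, jordanPoly (k + 1) (Function.update t i (s i))) := by
  induction k with
  | zero => simp [jordanPoly]
  | succ k ih =>
    have key := ih (Fin.init t) (Fin.init s)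
    rw [List.ofFn_succ', List.concat_eq_append, List.foldl_append]
    have h1 : (fun i : Fin k => (t i.castSucc.succ, s i.castSucc.succ)) =
        fun i : Fin k => (Fin.init t i.succ, Fin.init s i.succ) := by
      funext i; simp [Fin.init]
    have h2 : (t 0, s 0) = (Fin.init t 0, Fin.init s 0) := by simp [Fin.init]
    rw [h1, h2, key]
    simp only [List.foldl_cons, List.foldl_nil, dualJordanProd, Fin.succ_last]
    rw [Fin.sum_univ_castSucc (n := k + 1)]
    simp [jordanPoly, sum_jordanProd, Fin.init_update_castSucc, Fin.init_update_last, Fin.init]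
    refine Finset.sum_congr rfl fun i _ => ?_
    rw [Function.update_of_ne (Fin.castSucc_lt_last i).ne']

/-- One step in the evaluation of `qₙ` on `tᵢ + ε δ(tᵢ)`. -/
def jordanStep (δ : A → A) (p : A × A) (y : A) : A × A := dualJordanProd p (y, δ y)

/-- `Δ` and `δ` satisfy the generalized Leibniz rule for `q_{k+1}`, written as a left fold. -/
def JordanLeibniz (k : ℕ) (Δ δ : A → A) : Prop :=
  ∀ (x : A) (l : List A), l.length = k →
    Δ (l.foldl (jordanStep δ) (x, Δ x)).1 = (l.foldl (jordanStep δ) (x, Δ x)).2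

lemma foldl_jordanStep_eq (δ : A → A) (x x' : A) (l : List A) :
    l.foldl (jordanStep δ) (x, x') =
      (jordanPoly (l.length + 1) (Fin.cons x l.get : Fin (l.length + 1) → A),
        ∑ i, jordanPoly (l.length + 1) (Function.update (Fin.cons x l.get : Fin (l.length + 1) → A) i
          ((Fin.cons x' (fun i => δ (l.get i)) : Fin (l.length + 1) → A) i))) := by
  rw [← foldl_dualJordanProd_ofFn]
  have : List.ofFn (fun i : Fin l.length => (l.get i, δ (l.get i))) = l.map fun y => (y, δ y) := by
    conv_rhs => rw [← List.ofFn_get l, List.map_ofFn]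
    rfl
  simp only [Fin.cons_succ, Fin.cons_zero, this, List.foldl_map]
  rfl

lemma IsMulJordanDerivation.jordanLeibniz {k : ℕ} {δ : A → A}
    (h : IsMulJordanDerivation (k + 1) δ) : JordanLeibniz k δ δ := by
  rintro x l rfl
  rw [foldl_jordanStep_eq]
  simp only
  rw [h]
  refine Finset.sum_congr rfl fun i _ => ?_
  congr 2
  refine Fin.cases ?_ (fun j => ?_) i <;> simp

lemma jordanLeibniz_of_gen {k : ℕ} {Δ δ : A → A}
    (h : ∀ t : Fin (k + 1) → A, Δ (jordanPoly (k + 1) t) =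
        jordanPoly (k + 1) (Function.update t 0 (Δ (t 0))) +
          ∑ i ∈ Finset.univ.filter (fun i : Fin (k + 1) => i ≠ 0),
            jordanPoly (k + 1) (Function.update t i (δ (t i)))) : JordanLeibniz k Δ δ := by
  rintro x l rfl
  rw [foldl_jordanStep_eq]
  simp only
  rw [h, Finset.filter_ne', ← Finset.add_sum_erase _ _ (Finset.mem_univ 0)]
  congr 1
  refine Finset.sum_congr rfl fun i hi => ?_
  congr 2
  obtain ⟨j, rfl⟩ := Fin.exists_succ_eq.2 (Finset.ne_of_mem_erase hi)
  simp

lemma IsRingDerivation.map_jordanProd {D : A → A} (hD : IsRingDerivation D) (a b : A) :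
    D (jordanProd a b) = jordanProd (D a) b + jordanProd a (D b) := by
  simp only [jordanProd, hD.map_add, hD.leibniz]; abel

/-- For a derivation `D`, the shear `p + εp' ↦ p + ε(p' - D p)` respects the Jordan product of dual
numbers. Hence derivations may be subtracted from both maps of a Leibniz rule. -/
lemma foldl_jordanStep_sub {D : A → A} (hD : IsRingDerivation D) (δ : A → A) (l : List A) :
    ∀ p : A × A, l.foldl (jordanStep fun y => δ y - D y) (p.1, p.2 - D p.1) =
      ((l.foldl (jordanStep δ) p).1,
        (l.foldl (jordanStep δ) p).2 - D (l.foldl (jordanStep δ) p).1) := by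
  induction l with
  | nil => intro p; rfl
  | cons y l ih =>
    intro p
    rw [List.foldl_cons, List.foldl_cons, ← ih (jordanStep δ p y)]
    congr 1
    simp only [jordanStep, dualJordanProd, hD.map_jordanProd, Prod.mk.injEq, true_and]
    simp only [jordanProd]
    noncomm_ring

lemma JordanLeibniz.sub {k : ℕ} {Δ δ D : A → A} (h : JordanLeibniz k Δ δ)
    (hD : IsRingDerivation D) :
    JordanLeibniz k (fun x => Δ x - D x) (fun x => δ x - D x) := by
  intro x l hl
  have h1 := foldl_jordanStep_sub hD δ l (x, Δ x)
  simp only at h1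
  simp only [h1, h x l hl]

lemma isRingDerivation_inner (a : A) : IsRingDerivation fun x : A => x * a - a * x where
  map_add x y := by noncomm_ring
  leibniz x y := by noncomm_ring

lemma IsRingDerivation.add {D E : A → A} (hD : IsRingDerivation D) (hE : IsRingDerivation E) :
    IsRingDerivation fun x => D x + E x where
  map_add x y := by rw [hD.map_add, hE.map_add]; abel
  leibniz x y := by rw [hD.leibniz, hE.leibniz]; noncomm_ring

lemma foldl_replicate_jordanStep {δ : A → A} {e : A} (he : δ e = 0) (j : ℕ) :
    ∀ p : A × A, (List.replicate j e).foldl (jordanStep δ) p =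
      ((jordanProd · e)^[j] p.1, (jordanProd · e)^[j] p.2) := by
  induction j with
  | zero => intro p; rfl
  | succ j ih => intro p; simp [List.replicate_succ, ih, jordanStep, dualJordanProd, he]

lemma iterate_jordanProd_of_fixed {e m : A} (h : jordanProd m e = m) (j : ℕ) :
    (jordanProd · e)^[j] m = m := by
  induction j with
  | zero => rfl
  | succ j ih => rw [Function.iterate_succ_apply, h, ih]

lemma JordanLeibniz.map_zero {k : ℕ} {Δ δ : A → A} (h : JordanLeibniz (k + 1) Δ δ) :
    Δ 0 = 0 := by
  have hz : ∀ j : ℕ, (List.replicate j (0 : A)).foldl (jordanStep δ) (0, 0) = (0, 0) := by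
    intro j
    induction j with
    | zero => rfl
    | succ j ih => simp [List.replicate_succ, ih, jordanStep, dualJordanProd]
  have h0 := h 0 (List.replicate (k + 1) 0) (by simp)
  have h1 : (List.replicate (k + 1) (0 : A)).foldl (jordanStep δ) (0, Δ 0) = (0, 0) := by
    rw [List.replicate_succ, List.foldl_cons, ← hz k]
    simp [jordanStep, dualJordanProd]
  rw [h1] at h0
  exact h0

end Polarization

/-! ### Triangular idempotents and Peirce components. -/

section Triangular

variable {A : Type*} [Ring A]

/-- `m` lies in the corner `eA(1 - e)`. -/
def IsOffDiag (e m : A) : Prop := e * m = m ∧ m * e = 0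

/-- An idempotent `e` with `(1 - e)Ae = 0` for which `eA(1 - e)` is faithful as a left
`eAe`-module and as a right `(1 - e)A(1 - e)`-module. -/
structure IsTriangularIdempotent (e : A) : Prop where
  idem : e * e = e
  tri : ∀ x, e * x * e = x * e
  left_faithful : ∀ x, (∀ m, IsOffDiag e m → x * m = 0) → x * e = 0
  right_faithful : ∀ x, (∀ m, IsOffDiag e m → m * x = 0) → e * x = x

namespace IsOffDiag

variable {e m m' : A}

lemma jordanProd_self (h : IsOffDiag e m) : jordanProd m e = m := by
  simp [jordanProd, h.1, h.2]

lemma add (h : IsOffDiag e m) (h' : IsOffDiag e m') : IsOffDiag e (m + m') :=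
  ⟨by rw [mul_add, h.1, h'.1], by rw [add_mul, h.2, h'.2, add_zero]⟩

lemma mul_offDiag (h : IsOffDiag e m) (h' : IsOffDiag e m') : m * m' = 0 := by
  rw [← h'.1, ← mul_assoc, h.2, zero_mul]

end IsOffDiag

namespace IsTriangularIdempotent

variable {e : A} (he : IsTriangularIdempotent e)
include he

lemma mul_mul (x y : A) : e * (x * (e * y)) = x * (e * y) := by
  simp only [← mul_assoc, he.tri]

lemma offDiag_left {m : A} (h : IsOffDiag e m) (x : A) : IsOffDiag e (x * m) :=
  ⟨by rw [← h.1, he.mul_mul], by rw [mul_assoc, h.2, mul_zero]⟩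

lemma offDiag_right {m : A} (h : IsOffDiag e m) (x : A) : IsOffDiag e (m * x) :=
  ⟨by rw [← mul_assoc, h.1], by rw [mul_assoc, ← he.tri, mul_assoc, ← mul_assoc, h.2, zero_mul]⟩

lemma offDiag_jordanProd {m : A} (h : IsOffDiag e m) (x : A) : IsOffDiag e (jordanProd m x) :=
  (he.offDiag_right h x).add (he.offDiag_left h x)

lemma offDiag_part (x : A) : IsOffDiag e (e * x - x * e) :=
  ⟨by rw [mul_sub, ← mul_assoc, ← mul_assoc, he.idem, he.tri],
   by rw [sub_mul, he.tri, mul_assoc, he.idem, sub_self]⟩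

/-- The test for all later identities: the first two hypotheses kill the diagonal corners `r * e`
and `r - e * r`, the third the off-diagonal one. -/
lemma eq_zero {r : A} (h1 : ∀ m, IsOffDiag e m → r * m = 0)
    (h2 : ∀ m, IsOffDiag e m → m * r = 0) (h3 : e * r = r * e) : r = 0 := by
  rw [← he.right_faithful r h2, h3, he.left_faithful r h1]

lemma eq_zero_of_jordanProd_eq_zero {x : A} (hx : ∀ m, IsOffDiag e m → jordanProd m x = 0)
    (h1 : e * x = 0) : x = 0 := by
  rw [← he.right_faithful x fun m hm => ?_, h1]
  have h2 : x * m = 0 := by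
    rw [← (he.offDiag_left hm x).1, ← mul_assoc, h1, zero_mul]
  have := hx m hm
  rwa [jordanProd, h2, add_zero] at this

/-- As `(1 - e)Ae = 0`, the corner components of `x` are `x * e`, `e * x - x * e` and `x - e * x`,
with eigenvalues 2, 1, 0. At least one iteration is needed to remove the last. -/
lemma iterate_jordanProd [Algebra ℂ A] (k : ℕ) (x : A) :
    (jordanProd · e)^[k + 1] x = (2 : ℂ) ^ (k + 1) • (x * e) + (e * x - x * e) := by
  induction k with
  | zero => simp only [zero_add, Function.iterate_one, jordanProd, pow_one, two_smul]; abel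
  | succ k ih =>
    rw [Function.iterate_succ_apply', ih, add_jordanProd, (he.offDiag_part x).jordanProd_self]
    congr 1
    rw [jordanProd, smul_mul_assoc, mul_smul_comm, mul_assoc, he.idem, ← mul_assoc, he.tri]
    module

lemma part_iterate (k : ℕ) (x : A) :
    e * (jordanProd · e)^[k] x - (jordanProd · e)^[k] x * e = e * x - x * e := by
  induction k generalizing x with
  | zero => rfl
  | succ k ih =>
    rw [Function.iterate_succ_apply, ih]
    simp only [jordanProd, mul_add, add_mul, ← mul_assoc, he.tri, he.idem]
    simp only [mul_assoc, he.idem]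
    abel

end IsTriangularIdempotent

lemma iterate_jordanProd_one [Algebra ℂ A] (k : ℕ) (x : A) :
    (jordanProd · 1)^[k] x = (2 : ℂ) ^ k • x := by
  induction k with
  | zero => simp
  | succ k ih =>
    rw [Function.iterate_succ_apply', ih, jordanProd, mul_one, one_mul]
    module

lemma eq_zero_of_two_pow_smul_eq [Module ℂ A] {k : ℕ} {z : A}
    (h : (2 : ℂ) ^ (k + 1) • z = z) : z = 0 := by
  have h1 : ((2 : ℂ) ^ (k + 1) - 1) • z = 0 := by rw [sub_smul, h, one_smul, sub_self]
  refine (smul_eq_zero.1 h1).resolve_left ?_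
  have : (2 : ℕ) ^ (k + 1) ≠ 1 := by simp
  exact sub_ne_zero.2 (by exact_mod_cast this)

end Triangular

/-! ### Action on the off-diagonal corner. -/

namespace JordanLeibniz

variable {A : Type*} [Ring A] [Algebra ℂ A] {e : A} {k : ℕ} {δ : A → A}

section OffDiag

variable (he : IsTriangularIdempotent e)
include he

lemma foldl_replicate_offDiag {m : A} (hm : IsOffDiag e m) (x : A) (j : ℕ) :
    (List.replicate j e).foldl (jordanStep δ) (m, x) =
      (m, (jordanProd · e)^[j] x + (j : ℂ) • jordanProd m (δ e)) := by
  induction j generalizing x with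
  | zero => simp
  | succ j ih =>
    -- Each slot `e` contributes the same `m ∘ δ e`, because later factors `e` fix this off-diagonal
    -- element.
    have hw := (he.offDiag_jordanProd hm (δ e)).jordanProd_self
    have hadd : ∀ (i : ℕ) (y z : A), (jordanProd · e)^[i] (y + z) =
        (jordanProd · e)^[i] y + (jordanProd · e)^[i] z := by
      intro i
      induction i with
      | zero => intro y z; rfl
      | succ i ih => intro y z; simp only [Function.iterate_succ_apply, add_jordanProd, ih]
    have h1 : jordanStep δ (m, x) e = (m, jordanProd x e + jordanProd m (δ e)) := by
      simp [jordanStep, dualJordanProd, hm.jordanProd_self]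
    rw [List.replicate_succ, List.foldl_cons, h1, ih, hadd, iterate_jordanProd_of_fixed hw,
      Function.iterate_succ_apply]
    push_cast
    congr 1
    module

variable (h : JordanLeibniz (k + 1) δ δ)
include h

/-- Expand `δ` at `m = qₙ(m, e, …, e)` and compare corners: the `eAe` part of `δ m` equals `2 ^ (k +
1)` times itself, the `(1 - e)A(1 - e)` part is annihilated, and the off-diagonal part leaves `(k +
1) • (m ∘ δ e) = 0`. -/
lemma offDiag_aux {m : A} (hm : IsOffDiag e m) :
    IsOffDiag e (δ m) ∧ jordanProd m (δ e) = 0 := by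
  have h0 := h m (List.replicate (k + 1) e) (by simp)
  rw [foldl_replicate_offDiag he hm] at h0
  simp only [he.iterate_jordanProd] at h0
  set w := jordanProd m (δ e) with hw
  have hwo : IsOffDiag e w := he.offDiag_jordanProd hm _
  have hp := he.offDiag_part (δ m)
  have h1 : δ m * e = 0 := by
    have := congrArg (· * e) h0
    simp only [add_mul, smul_mul_assoc, hwo.2, hp.2, mul_assoc, he.idem] at this
    simp only [smul_zero, add_zero] at this
    exact eq_zero_of_two_pow_smul_eq this.symm
  have h2 : e * δ m = δ m := by
    have := congrArg (e * ·) h0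
    simp only [mul_add, mul_smul_comm, hwo.1, hp.1, ← mul_assoc, he.tri] at this
    exact this.trans h0.symm
  refine ⟨⟨h2, h1⟩, ?_⟩
  rw [h1, h2, smul_zero, sub_zero, zero_add] at h0
  have h3 : ((k + 1 : ℕ) : ℂ) • w = 0 := by simpa using h0
  exact (smul_eq_zero.1 h3).resolve_left (by exact_mod_cast k.succ_ne_zero)

lemma offDiag {m : A} (hm : IsOffDiag e m) : IsOffDiag e (δ m) := (offDiag_aux he h hm).1

lemma map_offDiag_jordanProd {m : A} (hm : IsOffDiag e m) (x : A) :
    δ (jordanProd m x) = jordanProd (δ m) x + jordanProd m (δ x) := by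
  have h0 := h m (List.replicate k e ++ [x]) (by simp)
  rw [List.foldl_append, foldl_replicate_offDiag he hm, (offDiag_aux he h hm).2, smul_zero,
    add_zero, iterate_jordanProd_of_fixed (offDiag he h hm).jordanProd_self] at h0
  simpa [jordanStep, dualJordanProd] using h0

lemma jordanProd_map_eq_zero {x : A} (hx : ∀ m, IsOffDiag e m → jordanProd m x = m)
    {m : A} (hm : IsOffDiag e m) : jordanProd m (δ x) = 0 := by
  have := map_offDiag_jordanProd he h hm x
  rwa [hx m hm, hx _ (offDiag he h hm), left_eq_add] at this

lemma map_offDiag_add {m m' : A} (hm : IsOffDiag e m) (hm' : IsOffDiag e m') :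
    δ (m + m') = δ m + δ m' := by
  have hzero : IsOffDiag e (0 : A) := ⟨mul_zero _, zero_mul _⟩
  -- Since `(e + m) ∘ (1 - e + m') = m + m'`, and both factors act on the off-diagonal corner as the
  -- identity, the cross terms vanish and `δ (m + m')` splits as `f m + g m'`. The case `f 0 + g 0 =
  -- 0` then gives additivity.
  have key : ∀ m m' : A, IsOffDiag e m → IsOffDiag e m' → δ (m + m') =
      (e * δ (e + m) - δ (e + m) * e) + (e * δ (1 - e + m') - δ (1 - e + m') * e) := by
    intro m m' hm hm'
    have hmm := hm.add hm'
    have ha : ∀ m₁, IsOffDiag e m₁ → jordanProd m₁ (δ (e + m)) = 0 := fun m₁ hm₁ =>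
      jordanProd_map_eq_zero he h (fun m₂ hm₂ => by
        rw [jordanProd_add, hm₂.jordanProd_self, jordanProd, hm₂.mul_offDiag hm,
          hm.mul_offDiag hm₂, add_zero, add_zero]) hm₁
    have hb : ∀ m₁, IsOffDiag e m₁ → jordanProd m₁ (δ (1 - e + m')) = 0 := fun m₁ hm₁ =>
      jordanProd_map_eq_zero he h (fun m₂ hm₂ => by
        simp [jordanProd, mul_add, add_mul, mul_sub, sub_mul, hm₂.mul_offDiag hm',
          hm'.mul_offDiag hm₂, hm₂.1, hm₂.2]) hm₁
    have hfst : jordanProd (e + m) (1 - e + m') = m + m' := by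
      simp only [jordanProd, mul_add, add_mul, mul_sub, sub_mul, hm.mul_offDiag hm',
        hm'.mul_offDiag hm, hm.1, hm.2, hm'.1, hm'.2, he.idem, mul_one, one_mul]
      abel
    have h0 := h (e + m) ((1 - e + m') :: List.replicate k e) (by simp)
    rw [List.foldl_cons, show ∀ x, jordanStep δ (e + m, x) (1 - e + m') = (m + m',
        jordanProd x (1 - e + m') + jordanProd (e + m) (δ (1 - e + m'))) from
        fun x => by rw [← hfst]; rfl,
      foldl_replicate_offDiag he hmm, (offDiag_aux he h hmm).2, smul_zero, add_zero,
      jordanProd_add, jordanProd_comm _ m', ha m' hm', add_jordanProd, hb m hm] at h0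
    simp only [add_zero] at h0
    have h1 := congrArg (fun x => e * x - x * e) h0
    simp only [he.part_iterate, (offDiag he h hmm).1, (offDiag he h hmm).2, sub_zero] at h1
    rw [h1]
    simp only [jordanProd, mul_add, add_mul, mul_sub, sub_mul, ← mul_assoc, he.idem, he.tri,
      mul_one, one_mul]
    simp only [mul_assoc, he.idem]
    abel
  have h0 := key 0 0 hzero hzero
  have h1 := key m 0 hm hzero
  have h2 := key 0 m' hzero hm'
  simp only [add_zero, zero_add, h.map_zero] at h0 h1 h2
  rw [key m m' hm hm', h1, h2]
  have h3 : ∀ a b c d : A, 0 = a + b → c + d = (c + b) + (a + d) := by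
    intro a b c d hab
    rw [show (c + b) + (a + d) = c + d + (a + b) by abel, ← hab, add_zero]
  exact h3 _ _ _ _ h0

end OffDiag

end JordanLeibniz

/-! ### Derivations: the normalized case and the reduction to it. -/

namespace JordanLeibniz

variable {A : Type*} [Ring A] [Algebra ℂ A] {e : A} {k : ℕ} {δ : A → A}

section Normalized

variable (he : IsTriangularIdempotent e) (h : JordanLeibniz (k + 1) δ δ)

/-- Each of the `j` slots contributes `2 ^ (j - 1)` times `x ∘ δ 1`; writing `2 ^ j / 2` avoids
truncated subtraction. -/
lemma foldl_replicate_one (x x' : A) (j : ℕ) :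
    (List.replicate j 1).foldl (jordanStep δ) (x, x') =
      ((2 : ℂ) ^ j • x,
        (2 : ℂ) ^ j • x' + ((j : ℂ) * 2 ^ j / 2) • jordanProd x (δ 1)) := by
  induction j generalizing x x' with
  | zero => simp
  | succ j ih =>
    rw [List.replicate_succ, List.foldl_cons]
    have h1 : jordanStep δ (x, x') 1 = ((2 : ℂ) • x, (2 : ℂ) • x' + jordanProd x (δ 1)) := by
      simp [jordanStep, dualJordanProd, jordanProd, two_smul]
    rw [h1, ih]
    simp only [jordanProd, smul_mul_assoc, mul_smul_comm, Prod.mk.injEq]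
    push_cast
    constructor
    · module
    · module

include he in
lemma foldl_replicate_self (hc : e * δ e = δ e * e) (j : ℕ) :
    (List.replicate (j + 1) e).foldl (jordanStep δ) (e, δ e) =
      ((2 : ℂ) ^ (j + 1) • e, ((j + 2 : ℂ) * 2 ^ (j + 1)) • (δ e * e)) := by
  induction j with
  | zero =>
    simp [jordanStep, dualJordanProd, jordanProd, he.idem, hc]
    constructor <;> module
  | succ j ih =>
    rw [List.replicate_succ', List.foldl_append, ih]
    simp only [List.foldl_cons, List.foldl_nil, jordanStep, dualJordanProd, jordanProd,
      smul_mul_assoc, mul_smul_comm, hc, mul_assoc, he.idem, Prod.mk.injEq]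
    simp only [← mul_assoc, hc]
    simp only [mul_assoc, he.idem]
    push_cast
    constructor <;> module

variable (hc : e * δ e = δ e * e)
include he h hc

/-- The element `2 ^ (k + 1) • e` is both `qₙ(e, e, …, e)` and `qₙ(e, 1, …, 1)`; comparing the two
expansions of its image puts `δ e` in `eAe`, where faithfulness kills it. -/
lemma map_idem_and_map_one : δ e = 0 ∧ δ 1 = 0 := by
  have h1 := h e (List.replicate (k + 1) e) (by simp)
  have h2 := h e (List.replicate (k + 1) 1) (by simp)
  rw [foldl_replicate_self he hc] at h1
  rw [foldl_replicate_one] at h2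
  simp only at h1 h2
  rw [h1] at h2
  have he0 : δ e = 0 := by
    have h3 : e * δ e = δ e := by
      have := congrArg (e * ·) h2
      have h4 : e * (jordanProd e (δ 1)) = jordanProd e (δ 1) := by
        simp only [jordanProd, mul_add, ← mul_assoc, he.idem, he.tri]
      simp only [mul_add, mul_smul_comm, h4, ← mul_assoc, he.tri] at this
      have h5 := this.symm.trans h2
      rw [add_left_inj] at h5
      exact smul_right_injective A (pow_ne_zero (k + 1) (two_ne_zero (α := ℂ))) h5
    rw [← h3, hc]
    refine he.left_faithful _ fun m hm => ?_
    have h6 := (offDiag_aux he h hm).2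
    have h7 : m * δ e = 0 := by rw [← h3, ← mul_assoc, hm.2, zero_mul]
    rwa [jordanProd, h7, zero_add] at h6
  refine ⟨he0, ?_⟩
  have hone : ∀ m, IsOffDiag e m → jordanProd m (δ 1) = 0 := by
    intro m hm
    have h3 := map_offDiag_jordanProd he h hm 1
    have h4 : ∀ x : A, jordanProd x 1 = x + x := fun x => by simp [jordanProd]
    rw [h4, h4, map_offDiag_add he h hm hm] at h3
    simpa using h3
  rw [he0] at h2
  have h3 : jordanProd e (δ 1) = 0 := by
    have h4 : (((k + 1 : ℕ) : ℂ) * 2 ^ (k + 1) / 2) • jordanProd e (δ 1) = 0 := by simpa using h2.symm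
    refine (smul_eq_zero.1 h4).resolve_left ?_
    have : ((k + 1 : ℕ) : ℂ) ≠ 0 := by exact_mod_cast k.succ_ne_zero
    simpa using this
  have h5 : δ 1 * e = 0 := by
    have := congrArg (· * e) h3
    simp only [jordanProd, add_mul, he.tri, mul_assoc, he.idem, zero_mul] at this
    rw [← two_smul ℂ] at this
    exact (smul_eq_zero.1 this).resolve_left two_ne_zero
  refine he.eq_zero_of_jordanProd_eq_zero hone ?_
  simpa [jordanProd, h5] using h3

lemma map_iterate (x : A) :
    δ ((jordanProd · e)^[k + 1] x) = (jordanProd · e)^[k + 1] (δ x) := by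
  have h1 := h x (List.replicate (k + 1) e) (by simp)
  rwa [foldl_replicate_jordanStep (map_idem_and_map_one he h hc).1] at h1

lemma map_two_pow_smul (x : A) : δ ((2 : ℂ) ^ (k + 1) • x) = (2 : ℂ) ^ (k + 1) • δ x := by
  have h1 := h x (List.replicate (k + 1) 1) (by simp)
  rw [foldl_replicate_jordanStep (map_idem_and_map_one he h hc).2] at h1
  simpa only [iterate_jordanProd_one] using h1

lemma map_one_sub : δ (1 - e) = 0 := by
  have h1 : (jordanProd · e)^[k + 1] (1 - e) = 0 := by
    rw [he.iterate_jordanProd]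
    simp [sub_mul, mul_sub, he.idem]
  have h2 := map_iterate he h hc (1 - e)
  rw [h1, h.map_zero, he.iterate_jordanProd] at h2
  have h3 := congrArg (· * e) h2
  simp only [zero_mul, add_mul, smul_mul_assoc, mul_assoc, he.idem,
    (he.offDiag_part (δ (1 - e))).2, add_zero] at h3
  have h4 : δ (1 - e) * e = 0 := (smul_eq_zero.1 h3.symm).resolve_left (by simp)
  refine he.eq_zero_of_jordanProd_eq_zero (fun m hm => ?_) ?_
  · refine jordanProd_map_eq_zero he h (fun m hm => ?_) hm
    simp [jordanProd, mul_sub, sub_mul, hm.1, hm.2]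
  · simpa [h4] using h2.symm

lemma map_mul_idem_of_mul_idem {b : A} (hb : b * e = b) : δ b * e = δ b ∧ e * δ b = δ b := by
  have heb : e * b = b := by rw [← hb, ← mul_assoc, he.tri]
  have h1 := map_iterate he h hc b
  rw [he.iterate_jordanProd, he.iterate_jordanProd, hb, heb, sub_self, add_zero,
    map_two_pow_smul he h hc] at h1
  have hp := he.offDiag_part (δ b)
  have h2 : e * δ b = δ b := by
    have := congrArg (e * ·) h1
    simp only [mul_add, mul_smul_comm, hp.1, ← mul_assoc, he.tri] at this
    exact smul_right_injective A (pow_ne_zero (k + 1) (two_ne_zero (α := ℂ))) (this.trans h1.symm)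
  refine ⟨?_, h2⟩
  rw [h2] at h1
  have h3 : (2 : ℂ) ^ (k + 1) • (δ b - δ b * e) = δ b - δ b * e := by
    rw [smul_sub, h1]; abel
  exact (sub_eq_zero.1 (eq_zero_of_two_pow_smul_eq h3)).symm

lemma idem_mul_map_eq_zero {d : A} (hd : e * d = 0) : e * δ d = 0 := by
  have hde : d * e = 0 := by rw [← he.tri, hd, zero_mul]
  have h1 := map_iterate he h hc d
  rw [he.iterate_jordanProd, he.iterate_jordanProd, hd, hde, smul_zero, sub_zero, add_zero,
    h.map_zero] at h1
  have h3 := congrArg (· * e) h1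
  simp only [zero_mul, add_mul, smul_mul_assoc, mul_assoc, he.idem,
    (he.offDiag_part (δ d)).2, add_zero] at h3
  have h4 : δ d * e = 0 := (smul_eq_zero.1 h3.symm).resolve_left (by simp)
  simpa [h4] using h1.symm

/-- `δ` respects the decomposition of `eA` into diagonal and off-diagonal parts. -/
lemma map_of_idem_mul {y : A} (hy : e * y = y) :
    δ y * e = δ (y * e) ∧ δ y = δ (y * e) + δ (y - y * e) := by
  have hoff : IsOffDiag e (y - y * e) := by
    have := he.offDiag_part y
    rwa [hy] at this
  have h1 : e * δ y = δ y := by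
    -- The argument is a preimage of `y` under the iterated product with `e`, whose values all lie
    -- in `eA`.
    have h2 := map_iterate he h hc (((2 : ℂ) ^ (k + 1))⁻¹ • (y * e) + (y - y * e))
    have h3 : (jordanProd · e)^[k + 1] (((2 : ℂ) ^ (k + 1))⁻¹ • (y * e) + (y - y * e)) = y := by
      rw [he.iterate_jordanProd]
      simp only [add_mul, mul_add, smul_mul_assoc, mul_smul_comm, hoff.1, hoff.2, mul_assoc,
        he.idem]
      simp only [← mul_assoc, he.tri]
      rw [add_zero, smul_inv_smul₀ (by simp)]
      abel
    rw [h3, he.iterate_jordanProd] at h2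
    rw [h2]
    simp only [mul_add, mul_smul_comm, (he.offDiag_part _).1, ← mul_assoc, he.tri]
  have hB := map_mul_idem_of_mul_idem he h hc (b := y * e) (by rw [mul_assoc, he.idem])
  have h4 : δ y * e = δ (y * e) := by
    rw [← hB.1, ← sub_eq_zero, ← sub_mul]
    refine he.left_faithful _ fun m hm => ?_
    have e1 := map_offDiag_jordanProd he h hm y
    have e2 := map_offDiag_jordanProd he h hm (y * e)
    have e3 : ∀ z w : A, IsOffDiag e z → e * w = w → jordanProd z w = w * z := by
      intro z w hz hw
      rw [jordanProd, ← hw, ← mul_assoc, hz.2, zero_mul, zero_add]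
    have hye : e * (y * e) = y * e := by rw [← mul_assoc, he.tri]
    have hm' := offDiag he h hm
    rw [e3 _ _ hm hy, e3 _ _ hm' hy, e3 _ _ hm h1] at e1
    rw [e3 _ _ hm hye, e3 _ _ hm' hye, e3 _ _ hm hB.2, mul_assoc y, mul_assoc y, hm.1, hm'.1,
      e1, add_right_inj] at e2
    rw [sub_mul, e2, sub_self]
  refine ⟨h4, ?_⟩
  -- One factor `1 - e` extracts the off-diagonal part of `y`, which the remaining factors `e` fix.
  have h5 := h y ((1 - e) :: List.replicate k e) (by simp)
  rw [List.foldl_cons, foldl_replicate_jordanStep (map_idem_and_map_one he h hc).1] at h5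
  have h6 : ∀ z : A, e * z = z → jordanProd z (1 - e) = z - z * e := by
    intro z hz; simp [jordanProd, mul_sub, sub_mul, hz]
  have hoff' : IsOffDiag e (δ y - δ y * e) := by
    have := he.offDiag_part (δ y)
    rwa [h1] at this
  simp only [jordanStep, dualJordanProd, map_one_sub he h hc, jordanProd_zero, add_zero,
    h6 y hy, h6 _ h1, iterate_jordanProd_of_fixed hoff.jordanProd_self,
    iterate_jordanProd_of_fixed hoff'.jordanProd_self] at h5
  rw [h5, h4]
  abel

lemma map_peirce (x : A) : δ x * e = δ (x * e) ∧ e * δ x - δ x * e = δ (e * x - x * e) ∧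
    δ x - e * δ x = δ (x - e * x) := by
  have hp := he.offDiag_part x
  have hB := map_mul_idem_of_mul_idem he h hc (b := x * e) (by rw [mul_assoc, he.idem])
  have h1 := map_iterate he h hc x
  have hy : e * ((2 : ℂ) ^ (k + 1) • (x * e) + (e * x - x * e)) =
      (2 : ℂ) ^ (k + 1) • (x * e) + (e * x - x * e) := by
    rw [mul_add, hp.1, mul_smul_comm, ← mul_assoc, he.tri]
  have h2 := (map_of_idem_mul he h hc hy).2
  have h3 : ((2 : ℂ) ^ (k + 1) • (x * e) + (e * x - x * e)) * e = (2 : ℂ) ^ (k + 1) • (x * e) := by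
    rw [add_mul, hp.2, add_zero, smul_mul_assoc, mul_assoc, he.idem]
  rw [he.iterate_jordanProd, he.iterate_jordanProd] at h1
  rw [h3, add_sub_cancel_left, h1, map_two_pow_smul he h hc] at h2
  have hpm := offDiag he h hp
  have h4 : δ x * e = δ (x * e) := by
    have := congrArg (· * e) h2
    simp only [add_mul, smul_mul_assoc, (he.offDiag_part (δ x)).2, hpm.2, add_zero, hB.1,
      mul_assoc, he.idem] at this
    exact smul_right_injective A (pow_ne_zero (k + 1) (two_ne_zero (α := ℂ))) this
  refine ⟨h4, ?_, ?_⟩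
  · rw [h4, add_right_inj] at h2
    rw [h4, h2]
  · have hd : e * (x - e * x) = 0 := by rw [mul_sub, ← mul_assoc, he.idem, sub_self]
    have hD := idem_mul_map_eq_zero he h hc hd
    -- Subtracting the binary rules for `x * e` and `x - e * x` from that for `x` isolates `m * (δ x
    -- - δ (x - e * x)) = 0`.
    have h5 : e * (δ x - δ (x - e * x)) = δ x - δ (x - e * x) := by
      refine he.right_faithful _ fun m hm => ?_
      have e1 := map_offDiag_jordanProd he h hm x
      have e2 := map_offDiag_jordanProd he h hm (x * e)
      have e3 := map_offDiag_jordanProd he h hm (x - e * x)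
      have hm' := offDiag he h hm
      have f1 : ∀ z w : A, IsOffDiag e z → e * w = w → jordanProd z w = w * z := by
        intro z w hz hw
        rw [jordanProd, ← hw, ← mul_assoc, hz.2, zero_mul, zero_add]
      have f2 : ∀ z w : A, IsOffDiag e z → e * w = 0 → jordanProd z w = z * w := by
        intro z w hz hw
        rw [jordanProd, ← hz.1, ← mul_assoc w, ← he.tri, hw]; simp
      have f3 : e * (x * e) = x * e := by rw [← mul_assoc, he.tri]
      have f4 : ∀ z, IsOffDiag e z → z * (x - e * x) = z * x := by
        intro z hz; rw [mul_sub, ← mul_assoc, hz.2, zero_mul, sub_zero]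
      rw [f1 _ _ hm f3, f1 _ _ hm' f3, f1 _ _ hm hB.2, mul_assoc x, mul_assoc x, hm.1, hm'.1,
        ← h4, mul_assoc, hm.1] at e2
      rw [f2 _ _ hm hd, f2 _ _ hm' hd, f2 _ _ hm hD, f4 _ hm, f4 _ hm'] at e3
      rw [jordanProd, map_offDiag_add he h (he.offDiag_right hm x) (he.offDiag_left hm x), e2, e3,
        jordanProd, jordanProd] at e1
      rw [mul_sub, sub_eq_zero]
      have e4 := sub_eq_zero.2 e1.symm
      rw [← sub_eq_zero, ← e4]
      abel
    rw [mul_sub, hD, sub_zero] at h5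
    rw [h5]; abel

/-- One-sided products are Jordan products with a diagonal corner: `x * m = m ∘ (x * e)` and `m * x
= m ∘ (x - e * x)`. -/
lemma mul_map_offDiag {m : A} (hm : IsOffDiag e m) (x : A) :
    δ (x * m) = δ x * m + x * δ m ∧ δ (m * x) = δ m * x + m * δ x := by
  obtain ⟨p1, -, p3⟩ := map_peirce he h hc x
  have hm' := offDiag he h hm
  constructor
  · have e2 := map_offDiag_jordanProd he h hm (x * e)
    rw [← p1] at e2
    have f : ∀ z w : A, IsOffDiag e z → jordanProd z (w * e) = w * z := by
      intro z w hz
      rw [jordanProd, mul_assoc w, hz.1, ← he.tri, ← mul_assoc, ← mul_assoc, hz.2]; simp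
    rw [f _ _ hm, f _ _ hm', f _ _ hm] at e2
    rw [e2, add_comm]
  · have e3 := map_offDiag_jordanProd he h hm (x - e * x)
    rw [← p3] at e3
    have f : ∀ z w : A, IsOffDiag e z → jordanProd z (w - e * w) = z * w := by
      intro z w hz
      rw [jordanProd, mul_sub, ← mul_assoc, hz.2, ← hz.1, sub_mul, ← mul_assoc w, ← he.tri]
      simp [mul_assoc]
    rwa [f _ _ hm, f _ _ hm', f _ _ hm] at e3

lemma isRingDerivation_of_normalized : IsRingDerivation δ where
  map_add x y := by
    rw [← sub_eq_zero]
    refine he.eq_zero (fun m hm => ?_) (fun m hm => ?_) ?_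
    · have e1 := (mul_map_offDiag he h hc hm (x + y)).1
      have e2 := (mul_map_offDiag he h hc hm x).1
      have e3 := (mul_map_offDiag he h hc hm y).1
      rw [add_mul, map_offDiag_add he h (he.offDiag_left hm x) (he.offDiag_left hm y), e2, e3] at e1
      rw [← sub_eq_zero.2 e1.symm]
      noncomm_ring
    · have e1 := (mul_map_offDiag he h hc hm (x + y)).2
      have e2 := (mul_map_offDiag he h hc hm x).2
      have e3 := (mul_map_offDiag he h hc hm y).2
      rw [mul_add, map_offDiag_add he h (he.offDiag_right hm x) (he.offDiag_right hm y),
        e2, e3] at e1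
      rw [← sub_eq_zero.2 e1.symm]
      noncomm_ring
    · have e1 := (map_peirce he h hc (x + y)).2.1
      rw [show e * (x + y) - (x + y) * e = (e * x - x * e) + (e * y - y * e) by noncomm_ring,
        map_offDiag_add he h (he.offDiag_part x) (he.offDiag_part y),
        ← (map_peirce he h hc x).2.1, ← (map_peirce he h hc y).2.1] at e1
      rw [← sub_eq_zero, ← sub_eq_zero.2 e1]
      noncomm_ring
  leibniz x y := by
    rw [← sub_eq_zero]
    refine he.eq_zero (fun m hm => ?_) (fun m hm => ?_) ?_
    · have e1 := (mul_map_offDiag he h hc hm (x * y)).1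
      rw [mul_assoc, (mul_map_offDiag he h hc (he.offDiag_left hm y) x).1,
        (mul_map_offDiag he h hc hm y).1] at e1
      rw [← sub_eq_zero.2 e1.symm]
      noncomm_ring
    · have e1 := (mul_map_offDiag he h hc hm (x * y)).2
      rw [← mul_assoc, (mul_map_offDiag he h hc (he.offDiag_right hm x) y).2,
        (mul_map_offDiag he h hc hm x).2] at e1
      rw [← sub_eq_zero.2 e1.symm]
      noncomm_ring
    · have e1 := (map_peirce he h hc (x * y)).2.1
      have hx := he.offDiag_part x
      have hy := he.offDiag_part y
      rw [show e * (x * y) - x * y * e = x * (e * y - y * e) + (e * x - x * e) * y by noncomm_ring,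
        map_offDiag_add he h (he.offDiag_left hy x) (he.offDiag_right hx y),
        (mul_map_offDiag he h hc hy x).1, (mul_map_offDiag he h hc hx y).2,
        ← (map_peirce he h hc x).2.1, ← (map_peirce he h hc y).2.1] at e1
      rw [← sub_eq_zero, ← sub_eq_zero.2 e1]
      noncomm_ring

end Normalized

theorem isRingDerivation (he : IsTriangularIdempotent e) (h : JordanLeibniz (k + 1) δ δ) :
    IsRingDerivation δ := by
  -- The inner derivation `x ↦ x * a - a * x` sends `e` to `a`, the off-diagonal part of `δ e`;
  -- subtracting it makes the value at `e` commute with `e`.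
  set a := e * δ e - δ e * e with ha
  have hao : IsOffDiag e a := he.offDiag_part (δ e)
  have hD := isRingDerivation_inner a
  have h' := isRingDerivation_of_normalized he (h.sub hD) (by
    simp only [mul_sub, sub_mul, hao.1, hao.2, sub_zero]
    rw [ha]; abel)
  have := h'.add hD
  simpa using this

end JordanLeibniz

/-! ### Generalized derivations and central multipliers. -/

namespace JordanLeibniz

variable {A : Type*} [Ring A] [Algebra ℂ A] {e : A} {k : ℕ}

/-- A map with `Γ(qₙ(t₁, …, tₙ)) = qₙ(Γ(t₁), t₂, …, tₙ)` is multiplication by a central element. -/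
theorem exists_central_of_zero (he : IsTriangularIdempotent e) {Γ : A → A}
    (h : JordanLeibniz (k + 1) Γ fun _ => 0) :
    ∃ g : A, (∀ x, g * x = x * g) ∧ ∀ x, Γ x = g * x := by
  have hpow : (2 : ℂ) ^ k ≠ 0 := by simp
  have h1 : ∀ x y, Γ ((2 : ℂ) ^ k • jordanProd x y) = (2 : ℂ) ^ k • jordanProd (Γ x) y := by
    intro x y
    have h0 := h x (y :: List.replicate k 1) (by simp)
    rw [List.foldl_cons, foldl_replicate_jordanStep rfl] at h0
    simpa only [iterate_jordanProd_one, jordanStep, dualJordanProd, jordanProd_zero,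
      add_zero] using h0
  have hj1 : ∀ x : A, jordanProd x 1 = (2 : ℂ) • x := fun x => by simp [jordanProd, two_smul]
  set g := Γ 1 with hg
  -- Symmetry of `x ∘ 1 = 1 ∘ x` gives `Γ x ∘ 1 = g ∘ x`.
  have h3 : ∀ x, Γ x = (2⁻¹ : ℂ) • jordanProd g x := by
    intro x
    have h2 := h1 x 1
    rw [jordanProd_comm, h1] at h2
    rw [smul_right_injective A hpow h2, hj1, inv_smul_smul₀ two_ne_zero]
  have h4 : ∀ x y, jordanProd g (jordanProd x y) = jordanProd (jordanProd g x) y := by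
    intro x y
    have h2 := h1 x y
    rw [h3, h3] at h2
    simp only [jordanProd, smul_mul_assoc, mul_smul_comm, ← smul_add] at h2
    rw [smul_comm] at h2
    exact smul_right_injective A (inv_ne_zero two_ne_zero) (smul_right_injective A hpow h2)
  -- At `x = y = e` the identity reads `2ge + 2eg = 3ge + eg`, because `ege = ge`.
  have h5 : e * g = g * e := by
    have h2 := h4 e e
    simp only [jordanProd, mul_add, add_mul, ← mul_assoc, he.idem, he.tri] at h2
    simp only [mul_assoc, he.idem] at h2
    rw [← sub_eq_zero, ← sub_eq_zero.2 h2]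
    abel
  have h6 : ∀ m, IsOffDiag e m → g * m = m * g := by
    intro m hm
    have h2 := h4 e m
    rw [jordanProd_comm e m, hm.jordanProd_self] at h2
    have hmg : m * (g * e) = 0 := by rw [← mul_assoc, (he.offDiag_right hm g).2]
    simp only [jordanProd, h5, mul_add, add_mul, mul_assoc, hm.1, hmg, add_zero] at h2
    exact (add_left_cancel h2).symm
  have h7 : ∀ x, g * x = x * g := by
    intro x
    rw [← sub_eq_zero]
    refine he.eq_zero (fun m hm => ?_) (fun m hm => ?_) ?_
    · rw [sub_mul, mul_assoc, h6 _ (he.offDiag_left hm x), mul_assoc, mul_assoc, h6 m hm, sub_self]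
    · rw [mul_sub, ← mul_assoc, ← h6 m hm, ← mul_assoc, ← h6 _ (he.offDiag_right hm x), mul_assoc,
        sub_self]
    · rw [← sub_eq_zero, ← sub_eq_zero.2 (h6 _ (he.offDiag_part x))]
      simp only [mul_sub, sub_mul, ← mul_assoc, h5]
      simp only [mul_assoc, h5]
      abel
  refine ⟨g, h7, fun x => ?_⟩
  rw [h3, jordanProd, ← h7 x, ← two_smul ℂ, inv_smul_smul₀ two_ne_zero]

/-- A pair satisfying the generalized Leibniz rule for `qₙ`, `n ≥ 2`, in a triangular algebra:
`δ` is a derivation and `Δ` differs from it by multiplication with a central element. -/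
theorem exists_central (he : IsTriangularIdempotent e) {Δ δ : A → A}
    (hΔ : JordanLeibniz (k + 1) Δ δ) (hδ : JordanLeibniz (k + 1) δ δ) :
    IsRingDerivation δ ∧ ∃ g : A, (∀ x, g * x = x * g) ∧ ∀ x, Δ x = g * x + δ x := by
  have hD := hδ.isRingDerivation he
  refine ⟨hD, ?_⟩
  have h := hΔ.sub hD
  simp only [sub_self] at h
  obtain ⟨g, hg, h2⟩ := exists_central_of_zero he h
  exact ⟨g, hg, fun x => by rw [← h2, sub_add_cancel]⟩

end JordanLeibniz

/-! ### Nest algebras: rank-one operators and the centre. -/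

section NestAlgebra

variable {H : Type*} [NormedAddCommGroup H] [InnerProductSpace ℂ H]

lemma IsNest.exists_nontrivial {N : Set (ClosedSubmodule ℂ H)} (hN : IsNest N)
    (hN' : N ≠ {⊥, ⊤}) : ∃ M ∈ N, M ≠ ⊥ ∧ M ≠ ⊤ := by
  by_contra! hcon
  refine hN' (Set.Subset.antisymm (fun M hM => ?_) ?_)
  · by_cases hb : M = ⊥
    · exact Or.inl hb
    · exact Or.inr (hcon M hM hb)
  · rintro M (rfl | rfl)
    exacts [hN.bot_mem, hN.top_mem]

/-- Every `L` in the chain is comparable with `M`: below `M` the operator vanishes on `L`, above `M`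
its range lies in `L`. -/
lemma rankOne_mem_nestAlgebra {N : Set (ClosedSubmodule ℂ H)} (hN : IsNest N)
    {M : ClosedSubmodule ℂ H} (hM : M ∈ N) {u v : H} (hu : u ∈ M) (hv : v ∈ M.toSubmoduleᗮ) :
    InnerProductSpace.rankOne ℂ u v ∈ nestAlgebra N := by
  intro L hL x hx
  rw [InnerProductSpace.rankOne_apply]
  rcases hN.chain.total hL hM with hle | hle
  · have : inner ℂ v x = 0 := (Submodule.mem_orthogonal' _ _).1 hv x (hle hx)
    rw [this, zero_smul]
    exact L.toSubmodule.zero_mem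
  · exact L.toSubmodule.smul_mem _ (hle hu)

lemma exists_mem_ne_zero {M : ClosedSubmodule ℂ H} (hB : M ≠ ⊥) : ∃ u ∈ M, u ≠ 0 := by
  by_contra! hcon
  refine hB (le_bot_iff.1 fun x hx => ?_)
  rw [hcon x hx]
  exact (⊥ : ClosedSubmodule ℂ H).toSubmodule.zero_mem

variable [CompleteSpace H]

/-- The orthogonal projection onto a closed subspace. -/
noncomputable def closedProj (M : ClosedSubmodule ℂ H) : H →L[ℂ] H :=
  haveI : CompleteSpace M.toSubmodule := M.isClosed.completeSpace_coe
  M.toSubmodule.starProjection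

lemma closedProj_mem (M : ClosedSubmodule ℂ H) (x : H) : closedProj M x ∈ M := by
  have : CompleteSpace M.toSubmodule := M.isClosed.completeSpace_coe
  exact M.toSubmodule.starProjection_apply_mem x

lemma closedProj_eq_self {M : ClosedSubmodule ℂ H} {x : H} (hx : x ∈ M) : closedProj M x = x := by
  have : CompleteSpace M.toSubmodule := M.isClosed.completeSpace_coe
  exact Submodule.starProjection_eq_self_iff.2 hx

lemma closedProj_sub_mem_orthogonal (M : ClosedSubmodule ℂ H) (x : H) :
    x - closedProj M x ∈ M.toSubmoduleᗮ := by
  have : CompleteSpace M.toSubmodule := M.isClosed.completeSpace_coe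
  exact M.toSubmodule.sub_starProjection_mem_orthogonal x

lemma exists_orthogonal_ne_zero {M : ClosedSubmodule ℂ H} (hT : M ≠ ⊤) : ∃ v ∈ M.toSubmoduleᗮ, v ≠ 0 := by
  by_contra! hcon
  refine hT (top_le_iff.1 fun x _ => ?_)
  have := hcon _ (closedProj_sub_mem_orthogonal M x)
  rw [sub_eq_zero.1 this]
  exact closedProj_mem M x

variable {N : Set (ClosedSubmodule ℂ H)} (hN : IsNest N) {M : ClosedSubmodule ℂ H} (hM : M ∈ N)
include hN hM

lemma closedProj_mem_nestAlgebra : closedProj M ∈ nestAlgebra N := by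
  intro L hL x hx
  rcases hN.chain.total hL hM with hle | hle
  · rwa [closedProj_eq_self (hle hx)]
  · exact hle (closedProj_mem M x)

/-- The projection onto `M ∈ N`, as an element of the nest algebra. -/
noncomputable def nestProj : nestAlgebra N := ⟨closedProj M, closedProj_mem_nestAlgebra hN hM⟩

/-- The operator `x ↦ ⟪v, x⟫ u` with `u ∈ M`, `v ∈ Mᗮ`, as an element of the nest algebra. -/
noncomputable def nestRankOne {u v : H} (hu : u ∈ M) (hv : v ∈ M.toSubmoduleᗮ) : nestAlgebra N :=
  ⟨InnerProductSpace.rankOne ℂ u v, rankOne_mem_nestAlgebra hN hM hu hv⟩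

lemma nestProj_apply (x : H) : (nestProj hN hM : H →L[ℂ] H) x = closedProj M x := rfl

lemma nestRankOne_apply {u v : H} (hu : u ∈ M) (hv : v ∈ M.toSubmoduleᗮ) (x : H) :
    (nestRankOne hN hM hu hv : H →L[ℂ] H) x = inner ℂ v x • u :=
  InnerProductSpace.rankOne_apply _ _ _

lemma isOffDiag_nestRankOne {u v : H} (hu : u ∈ M) (hv : v ∈ M.toSubmoduleᗮ) :
    IsOffDiag (nestProj hN hM) (nestRankOne hN hM hu hv) := by
  constructor
  · ext x
    change (nestProj hN hM : H →L[ℂ] H) ((nestRankOne hN hM hu hv : H →L[ℂ] H) x) =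
      (nestRankOne hN hM hu hv : H →L[ℂ] H) x
    rw [nestRankOne_apply, nestProj_apply, map_smul, closedProj_eq_self hu]
  · ext x
    change (nestRankOne hN hM hu hv : H →L[ℂ] H) ((nestProj hN hM : H →L[ℂ] H) x) = 0
    rw [nestRankOne_apply, nestProj_apply,
      (Submodule.mem_orthogonal' _ _).1 hv _ (closedProj_mem M x), zero_smul]

lemma isTriangularIdempotent_nestProj (hB : M ≠ ⊥) (hT : M ≠ ⊤) :
    IsTriangularIdempotent (nestProj hN hM) where
  idem := by
    ext x
    exact closedProj_eq_self (closedProj_mem M x)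
  tri T := by
    ext x
    exact closedProj_eq_self (T.2 M hM _ (closedProj_mem M x))
  left_faithful T h := by
    obtain ⟨v, hv, hv0⟩ := exists_orthogonal_ne_zero hT
    ext x
    have h1 := congrArg (fun S : nestAlgebra N => (S : H →L[ℂ] H) v)
      (h _ (isOffDiag_nestRankOne hN hM (closedProj_mem M x) hv))
    change (T : H →L[ℂ] H) ((nestRankOne hN hM (closedProj_mem M x) hv : H →L[ℂ] H) v) = 0 at h1
    rw [nestRankOne_apply, map_smul] at h1
    exact (smul_eq_zero.1 h1).resolve_left (inner_self_ne_zero.2 hv0)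
  right_faithful T h := by
    obtain ⟨u, hu, hu0⟩ := exists_mem_ne_zero hB
    ext x
    change closedProj M ((T : H →L[ℂ] H) x) = (T : H →L[ℂ] H) x
    set y := (T : H →L[ℂ] H) x with hy
    have hv := closedProj_sub_mem_orthogonal M y
    have h1 := congrArg (fun S : nestAlgebra N => (S : H →L[ℂ] H) x)
      (h _ (isOffDiag_nestRankOne hN hM hu hv))
    change (nestRankOne hN hM hu hv : H →L[ℂ] H) y = 0 at h1
    rw [nestRankOne_apply] at h1
    have h2 := (smul_eq_zero.1 h1).resolve_right hu0
    have h3 : inner ℂ (y - closedProj M y) (y - closedProj M y) = 0 := by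
      rw [inner_sub_right, h2, (Submodule.mem_orthogonal' _ _).1 hv _ (closedProj_mem M y),
        sub_zero]
    exact (sub_eq_zero.1 (inner_self_eq_zero.1 h3)).symm

/-- Commuting with the rank-one operators for a fixed `v` forces `g` to be a scalar `c` on `M`. Then
`g - c • 1` is central and annihilates the off-diagonal corner, so it is zero. -/
lemma nestAlgebra_central_eq_smul_one (hB : M ≠ ⊥) (hT : M ≠ ⊤) {g : nestAlgebra N}
    (hg : ∀ x, g * x = x * g) : ∃ c : ℂ, g = c • (1 : nestAlgebra N) := by
  have he := isTriangularIdempotent_nestProj hN hM hB hT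
  obtain ⟨v, hv, hv0⟩ := exists_orthogonal_ne_zero hT
  set c : ℂ := (inner ℂ v v)⁻¹ * inner ℂ v ((g : H →L[ℂ] H) v) with hc
  have hM1 : ∀ u ∈ M, (g : H →L[ℂ] H) u = c • u := by
    intro u hu
    have h1 := congrArg (fun S : nestAlgebra N => (S : H →L[ℂ] H) v)
      (hg (nestRankOne hN hM hu hv))
    change (g : H →L[ℂ] H) ((nestRankOne hN hM hu hv : H →L[ℂ] H) v) =
      (nestRankOne hN hM hu hv : H →L[ℂ] H) ((g : H →L[ℂ] H) v) at h1
    rw [nestRankOne_apply, nestRankOne_apply, map_smul] at h1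
    rw [hc, mul_smul, ← h1, inv_smul_smul₀ (inner_self_ne_zero.2 hv0)]
  have hoff : ∀ m, IsOffDiag (nestProj hN hM) m → (g - c • 1) * m = 0 := by
    intro m hm
    rw [← hm.1]
    ext x
    change (g : H →L[ℂ] H) (closedProj M ((m : H →L[ℂ] H) x)) -
      c • (closedProj M ((m : H →L[ℂ] H) x)) = 0
    rw [hM1 _ (closedProj_mem M _), sub_self]
  have hcomm : ∀ x, (g - c • 1) * x = x * (g - c • 1) := by
    intro x
    rw [sub_mul, mul_sub, hg, smul_mul_assoc, mul_smul_comm, one_mul, mul_one]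
  exact ⟨c, sub_eq_zero.1 <| he.eq_zero hoff (fun m hm => by rw [← hcomm, hoff m hm])
    (hcomm _).symm⟩

end NestAlgebra

theorem corollary4p4 {H : Type*} [NormedAddCommGroup H] [InnerProductSpace ℂ H] [CompleteSpace H]
    (N : Set (ClosedSubmodule ℂ H)) (hN : IsNest N) (hN' : N ≠ {⊥, ⊤})
    (n : ℕ) [NeZero n] (hn : 2 ≤ n)
    (Δ : nestAlgebra N → nestAlgebra N) (hΔ : IsMulGenJordanDerivation n Δ) :
    ∃ (μ : nestAlgebra N) (δ : nestAlgebra N → nestAlgebra N),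
      (∃ c : ℂ, μ = c • (1 : nestAlgebra N)) ∧ IsRingDerivation δ ∧
        ∀ t : nestAlgebra N, Δ t = μ * t + δ t := by
  obtain ⟨M, hM, hB, hT⟩ := hN.exists_nontrivial hN'
  obtain ⟨k, rfl⟩ := Nat.exists_eq_add_of_le' hn
  obtain ⟨δ, hδ, hgen⟩ := hΔ
  obtain ⟨hD, g, hg, h⟩ := JordanLeibniz.exists_central
    (isTriangularIdempotent_nestProj hN hM hB hT) (jordanLeibniz_of_gen (k := k + 1) hgen)
    (IsMulJordanDerivation.jordanLeibniz (k := k + 1) hδ)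
  exact ⟨g, δ, nestAlgebra_central_eq_smul_one hN hM hB hT hg, hD, h⟩
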